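/- Let $M_n(\mathbb R)$ denote the real $n\times n$ matrices and let $K^*=\{A\in M_n(\mathbb R) : \text{there is } X\in M_n(\mathbb R) \text{ with } e^X=A\}$ be the set of matrices admitting a real logarithm. Let $\varphi:M_n(\mathbb R)\to M_n(\mathbb R)$ be a bijective linear map for which there are $P,Q\in M_n(\mathbb R)$ such that either $\varphi(A)=PAQ$ for all $A\in M_n(\mathbb R)$, or $\varphi(A)=PA^{T}Q$ for all $A\in M_n(\mathbb R)$. Then $$\varphi(K^*)=K^*$$ if and only if there exist $R\in \mathrm{GL}_n(\mathbb R)$ and $c>0$ such that either $$\varphi(A)=c\,RAR^{-1}\ \text{ for all } A\in M_n(\mathbb R),\qquad\text{or}\qquad \varphi(A)=c\,RA^{T}R^{-1}\ \text{ for all } A\in M_n(\mathbb R).$$ Moreover, if $\varphi(K^*)=K^*$, then $QP=cI_n$ for some $c>0$. -/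

import Mathlib

open scoped Matrix

/-- The set of real `n × n` matrices admitting a real logarithm:
it consists of all `A` such that `exp X = A` for some real `n × n` matrix `X`. -/
def realLogSet (n : ℕ) : Set (Matrix (Fin n) (Fin n) ℝ) :=
  {A | ∃ X : Matrix (Fin n) (Fin n) ℝ, NormedSpace.exp X = A}

/-! The set K* is stable under conjugation, transposition and positive scaling, which gives the easy
direction. Conversely, if φ preserves K*, conjugating by P⁻¹ shows that right multiplication by M =
QP maps K* into itself. Rank-one perturbations 1 + xyᵀ with 1 + y·x > 0 lie in K*, and unless M is a
positive scalar, one of them makes (1 + xyᵀ)M have a negative eigenvalue of geometric multiplicity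
one, so no real square root and no real logarithm. -/

/-- If `E * E = α • E` with `α > -1`, then `1 + E` is an exponential. -/
theorem exists_exp_eq_one_add_of_sq_eq_smul {𝔸 : Type*} [NormedRing 𝔸] [NormedAlgebra ℝ 𝔸]
    [CompleteSpace 𝔸] {E : 𝔸} {α : ℝ} (hE : E * E = α • E) (hα : 0 < 1 + α) :
    ∃ X : 𝔸, NormedSpace.exp X = 1 + E := by
  by_cases h0 : α = 0
  · refine ⟨E, ?_⟩
    have h2 : ∀ k, E ^ (k + 2) = 0 := fun k => by
      rw [pow_add, pow_two, hE, h0, zero_smul, mul_zero]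
    refine (NormedSpace.exp_series_hasSum_exp' (𝕂 := ℝ) E).unique ?_
    have h := hasSum_sum_of_ne_finset_zero
      (f := fun k : ℕ => ((k.factorial : ℝ)⁻¹) • E ^ k) (s := Finset.range 2)
      (L := SummationFilter.unconditional ℕ) (fun k hk => by
        obtain ⟨j, rfl⟩ : ∃ j, k = j + 2 := ⟨k - 2, by simp at hk; omega⟩
        simp [h2])
    simpa [Finset.sum_range_succ] using h
  · set s : ℝ := Real.log (1 + α) / α
    have hpow : ∀ k, E ^ (k + 1) = α ^ k • E := fun k => by
      induction k with
      | zero => simp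
      | succ k ih => rw [pow_succ, ih, smul_mul_assoc, hE, smul_smul, pow_succ]
    have hs : Real.exp (s * α) = 1 + α := by
      rw [div_mul_cancel₀ _ h0, Real.exp_log hα]
    refine ⟨s • E, smul_right_injective 𝔸 h0 ?_⟩
    have h1 : HasSum (fun k : ℕ => (((k.factorial : ℝ)⁻¹) • (s * α) ^ k) • E)
        (Real.exp (s * α) • E) := by
      rw [Real.exp_eq_exp_ℝ]
      exact (NormedSpace.exp_series_hasSum_exp' (𝕂 := ℝ) (s * α)).smul_const E
    -- For k ≥ 1 the terms of α exp(sE) and exp(sα)E agree; this corrects the term k = 0, where they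
    -- are α and E.
    have h2 := h1.add (hasSum_ite_eq 0 (α • (1 : 𝔸) - E))
    refine ((NormedSpace.exp_series_hasSum_exp' (𝕂 := ℝ) (s • E)).const_smul α).unique ?_
    rw [hs] at h2
    convert h2 using 1
    · funext k
      cases k with
      | zero => simp
      | succ k =>
        simp only [smul_pow, hpow, smul_smul, Nat.succ_ne_zero, if_false, add_zero, smul_eq_mul]
        congr 1
        ring
    · simp only [smul_add, add_smul, one_smul]
      abel

namespace Matrix

theorem one_add_vecMulVec_mem_realLogSet {n : ℕ} (x y : Fin n → ℝ) (h : 0 < 1 + y ⬝ᵥ x) :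
    1 + vecMulVec x y ∈ realLogSet n := by
  let _ : NormedRing (Matrix (Fin n) (Fin n) ℝ) := Matrix.linftyOpNormedRing
  let _ : NormedAlgebra ℝ (Matrix (Fin n) (Fin n) ℝ) := Matrix.linftyOpNormedAlgebra
  refine exists_exp_eq_one_add_of_sq_eq_smul ?_ h
  rw [vecMulVec_mul_vecMulVec, vecMulVec_smul]

/-- A matrix with a real logarithm is a square, so it has no negative eigenvalue of geometric
multiplicity one. -/
theorem notMem_realLogSet_of_eigenspace {n : ℕ} {A : Matrix (Fin n) (Fin n) ℝ} {v : Fin n → ℝ}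
    {r : ℝ} (hr : r < 0) (hv : v ≠ 0) (hAv : A *ᵥ v = r • v)
    (huniq : ∀ u, A *ᵥ u = r • u → ∃ a : ℝ, u = a • v) : A ∉ realLogSet n := by
  rintro ⟨X, hX⟩
  set B := NormedSpace.exp ((2⁻¹ : ℝ) • X)
  have hB : B * B = A := by
    rw [← Matrix.exp_add_of_commute _ _ (Commute.refl _), ← add_smul]
    norm_num [hX]
  -- B commutes with A, so it preserves the eigenline: Bv = av, hence a² = r < 0.
  obtain ⟨a, ha⟩ := huniq (B *ᵥ v) (by
    rw [← hB, mulVec_mulVec, mul_assoc, hB, ← mulVec_mulVec, hAv, mulVec_smul])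
  have h : (a * a) • v = r • v := by
    rw [← hAv, ← hB, ← mulVec_mulVec, ha, mulVec_smul, ha, smul_smul]
  have := smul_left_injective ℝ hv h
  nlinarith [mul_self_nonneg a]

theorem exists_neg_forall_mulVec_eq_smul_imp {n : ℕ} (M : Matrix (Fin n) (Fin n) ℝ) :
    ∃ r < (0 : ℝ), ∀ u, M *ᵥ u = r • u → u = 0 := by
  obtain ⟨r, hr, hroot⟩ := (Set.Iio_infinite (0 : ℝ)).exists_notMem_finset M.charpoly.roots.toFinset
  refine ⟨r, hr, fun u hu => ?_⟩
  by_contra hne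
  apply hroot
  rw [Multiset.mem_toFinset, Polynomial.mem_roots M.charpoly_monic.ne_zero, Polynomial.IsRoot.def,
    eval_charpoly, ← exists_mulVec_eq_zero_iff]
  exact ⟨u, hne, by rw [sub_mulVec, hu, scalar_apply, ← smul_one_eq_diagonal, smul_mulVec,
    one_mulVec, sub_self]⟩

/-- Otherwise a rank-one A in K* makes AM = M + xzᵀ have a simple eigenline spanned by w, with
eigenvalue r < 0. -/
theorem dotProduct_inv_mulVec_nonpos {n : ℕ} {M : Matrix (Fin n) (Fin n) ℝ} (hM : IsUnit M.det)
    (hK : ∀ A ∈ realLogSet n, A * M ∈ realLogSet n) {z w : Fin n → ℝ} (hzw : z ⬝ᵥ w = -1) :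
    z ⬝ᵥ M⁻¹ *ᵥ w ≤ 0 := by
  by_contra! hpos
  obtain ⟨r, hr, hinj⟩ := exists_neg_forall_mulVec_eq_smul_imp M
  have hw : w ≠ 0 := by
    rintro rfl
    simp at hzw
  -- This x forces AMw = rw, and 1 + y·x becomes -r(z·M⁻¹w) > 0 for y = zM⁻¹.
  set x := M *ᵥ w - r • w with hx
  have hA : 1 + vecMulVec x (z ᵥ* M⁻¹) ∈ realLogSet n := by
    apply one_add_vecMulVec_mem_realLogSet
    rw [← dotProduct_mulVec, hx, mulVec_sub, mulVec_mulVec, nonsing_inv_mul _ hM, one_mulVec,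
      mulVec_smul, dotProduct_sub, dotProduct_smul, hzw, smul_eq_mul]
    nlinarith
  have hmul : ∀ u, ((1 + vecMulVec x (z ᵥ* M⁻¹)) * M) *ᵥ u = M *ᵥ u + (z ⬝ᵥ u) • x := fun u => by
    rw [add_mul, one_mul, vecMulVec_mul, vecMul_vecMul, nonsing_inv_mul _ hM, vecMul_one,
      add_mulVec, vecMulVec_mulVec, op_smul_eq_smul]
  refine notMem_realLogSet_of_eigenspace hr hw ?_ ?_ (hK _ hA)
  · rw [hmul, hzw, hx]
    module
  · intro u hu
    refine ⟨-(z ⬝ᵥ u), ?_⟩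
    rw [hmul, hx] at hu
    -- AMu = ru reads (M - r)(u + (z·u)w) = 0, and r is not an eigenvalue of M.
    have := hinj (u + (z ⬝ᵥ u) • w) (by
      rw [mulVec_add, mulVec_smul]
      rw [← sub_eq_zero] at hu ⊢
      rw [← hu]
      module)
    rw [neg_smul]
    exact eq_neg_of_add_eq_zero_left this

/-- For fixed w, an affine function of t bounded above along a line in {z·w = -1} is constant.
Taking w = eᵢ kills the off-diagonal entries; w = eᵢ + eⱼ equates the diagonal ones. -/
theorem eq_smul_one_of_dotProduct_mulVec_nonpos {n : ℕ} {N : Matrix (Fin n) (Fin n) ℝ}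
    (hN : ∀ z w : Fin n → ℝ, z ⬝ᵥ w = -1 → z ⬝ᵥ N *ᵥ w ≤ 0) :
    ∃ c : ℝ, 0 ≤ c ∧ N = c • (1 : Matrix (Fin n) (Fin n) ℝ) := by
  have hlin : ∀ a b : ℝ, (∀ t : ℝ, a + t * b ≤ 0) → b = 0 := fun a b h => by
    by_contra hb
    have := h ((1 - a) / b)
    rw [div_mul_cancel₀ _ hb] at this
    linarith
  have hzero : ∀ i j, i ≠ j → N j i = 0 := fun i j hij => by
    refine hlin (-N i i) _ fun t => ?_
    have := hN (-Pi.single i 1 + t • Pi.single j 1) (Pi.single i 1) (by simp [hij])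
    simpa [add_dotProduct] using this
  have heq : ∀ i j, N i i = N j j := fun i j => by
    by_cases hij : i = j
    · rw [hij]
    refine sub_eq_zero.mp (hlin (-N i i) _ fun t => ?_)
    have := hN (-Pi.single i 1 + t • (Pi.single i 1 - Pi.single j 1))
      (Pi.single i 1 + Pi.single j 1) (by simp [hij, Ne.symm hij])
    simp [add_dotProduct, sub_dotProduct, mulVec_add, hzero i j hij,
      hzero j i (Ne.symm hij)] at this
    linarith
  cases n with
  | zero => exact ⟨0, le_rfl, Subsingleton.elim _ _⟩
  | succ n =>
    refine ⟨N 0 0, ?_, ?_⟩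
    · simpa using hN (-Pi.single 0 1) (Pi.single 0 1) (by simp)
    · ext i j
      by_cases hij : i = j
      · subst hij
        simp [heq i 0]
      · simp [hij, hzero j i (Ne.symm hij)]

theorem exists_pos_eq_smul_one_of_mul_mem_realLogSet {n : ℕ} {M : Matrix (Fin n) (Fin n) ℝ}
    (hM : IsUnit M.det) (hK : ∀ A ∈ realLogSet n, A * M ∈ realLogSet n) :
    ∃ c : ℝ, 0 < c ∧ M = c • (1 : Matrix (Fin n) (Fin n) ℝ) := by
  obtain ⟨c, hc, h⟩ := eq_smul_one_of_dotProduct_mulVec_nonpos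
    fun z w hzw => dotProduct_inv_mulVec_nonpos hM hK hzw
  cases n with
  | zero => exact ⟨1, one_pos, Subsingleton.elim _ _⟩
  | succ n =>
    have h1 : c • M = 1 := by
      rw [← nonsing_inv_mul M hM, h, smul_mul_assoc, one_mul]
    have hc0 : c ≠ 0 := by
      rintro rfl
      simp at h1
    exact ⟨c⁻¹, inv_pos.mpr (hc.lt_of_ne hc0.symm), by rw [← h1, smul_smul, inv_mul_cancel₀ hc0,
      one_smul]⟩

theorem conj_mem_realLogSet {n : ℕ} (U : GL (Fin n) ℝ) {A : Matrix (Fin n) (Fin n) ℝ}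
    (hA : A ∈ realLogSet n) : (U : Matrix (Fin n) (Fin n) ℝ) * A *
      ((U⁻¹ : GL (Fin n) ℝ) : Matrix (Fin n) (Fin n) ℝ) ∈ realLogSet n := by
  obtain ⟨X, rfl⟩ := hA
  exact ⟨_, Matrix.exp_units_conj U X⟩

theorem transpose_mem_realLogSet {n : ℕ} {A : Matrix (Fin n) (Fin n) ℝ}
    (hA : A ∈ realLogSet n) : Aᵀ ∈ realLogSet n := by
  obtain ⟨X, rfl⟩ := hA
  exact ⟨_, Matrix.exp_transpose X⟩

theorem smul_mem_realLogSet {n : ℕ} {c : ℝ} (hc : 0 < c) {A : Matrix (Fin n) (Fin n) ℝ}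
    (hA : A ∈ realLogSet n) : c • A ∈ realLogSet n := by
  obtain ⟨X, rfl⟩ := hA
  refine ⟨diagonal (fun _ => Real.log c) + X, ?_⟩
  have hcomm : Commute (diagonal fun _ : Fin n => Real.log c) X := by
    rw [← smul_one_eq_diagonal]
    exact (Commute.one_left X).smul_left _
  rw [Matrix.exp_add_of_commute _ _ hcomm, Matrix.exp_diagonal]
  have : NormedSpace.exp (fun _ : Fin n => Real.log c) = fun _ => c := by
    funext i
    rw [Pi.coe_exp, ← Real.exp_eq_exp_ℝ, Real.exp_log hc]
  rw [this, ← smul_one_eq_diagonal, smul_mul_assoc, one_mul]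

end Matrix

open Matrix in
theorem image_realLogSet_eq_of_smul_conj {n : ℕ}
    {φ : Matrix (Fin n) (Fin n) ℝ → Matrix (Fin n) (Fin n) ℝ} {R : GL (Fin n) ℝ} {c : ℝ}
    (hc : 0 < c)
    (h : (∀ A, φ A = c • ((R : Matrix (Fin n) (Fin n) ℝ) * A *
            ((R⁻¹ : GL (Fin n) ℝ) : Matrix (Fin n) (Fin n) ℝ))) ∨
         (∀ A, φ A = c • ((R : Matrix (Fin n) (Fin n) ℝ) * Aᵀ *
            ((R⁻¹ : GL (Fin n) ℝ) : Matrix (Fin n) (Fin n) ℝ)))) :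
    φ '' realLogSet n = realLogSet n := by
  have hpre : ∀ B ∈ realLogSet n, ∃ A ∈ realLogSet n, c • ((R : Matrix (Fin n) (Fin n) ℝ) * A *
      ((R⁻¹ : GL (Fin n) ℝ) : Matrix (Fin n) (Fin n) ℝ)) = B := fun B hB => by
    refine ⟨_, conj_mem_realLogSet R⁻¹ (smul_mem_realLogSet (inv_pos.mpr hc) hB), ?_⟩
    rw [inv_inv, ← mul_assoc, ← mul_assoc, Units.mul_inv, one_mul, mul_assoc, Units.mul_inv,
      mul_one, smul_smul, mul_inv_cancel₀ hc.ne', one_smul]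
  apply Set.Subset.antisymm
  · rintro _ ⟨A, hA, rfl⟩
    rcases h with h | h <;> rw [h]
    · exact smul_mem_realLogSet hc (conj_mem_realLogSet R hA)
    · exact smul_mem_realLogSet hc (conj_mem_realLogSet R (transpose_mem_realLogSet hA))
  · intro B hB
    obtain ⟨A, hA, hAB⟩ := hpre B hB
    rcases h with h | h
    · exact ⟨A, hA, by rw [h, hAB]⟩
    · exact ⟨Aᵀ, transpose_mem_realLogSet hA, by rw [h, transpose_transpose, hAB]⟩

theorem mainTheorem2 (n : ℕ)
    (φ : Matrix (Fin n) (Fin n) ℝ →ₗ[ℝ] Matrix (Fin n) (Fin n) ℝ)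
    (hφ : Function.Bijective φ)
    (P Q : Matrix (Fin n) (Fin n) ℝ)
    (hform : (∀ A, φ A = P * A * Q) ∨ (∀ A, φ A = P * Aᵀ * Q)) :
    (φ '' realLogSet n = realLogSet n ↔
      ∃ (R : Matrix.GeneralLinearGroup (Fin n) ℝ) (c : ℝ), 0 < c ∧
        ((∀ A, φ A = c • ((R : Matrix (Fin n) (Fin n) ℝ) * A *
            ((R⁻¹ : Matrix.GeneralLinearGroup (Fin n) ℝ) : Matrix (Fin n) (Fin n) ℝ))) ∨
         (∀ A, φ A = c • ((R : Matrix (Fin n) (Fin n) ℝ) * Aᵀ *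
            ((R⁻¹ : Matrix.GeneralLinearGroup (Fin n) ℝ) : Matrix (Fin n) (Fin n) ℝ))))) ∧
    (φ '' realLogSet n = realLogSet n →
      ∃ c : ℝ, 0 < c ∧ Q * P = c • (1 : Matrix (Fin n) (Fin n) ℝ)) := by
  obtain ⟨C, hC⟩ : ∃ C, P * C * Q = 1 := by
    obtain ⟨A, hA⟩ := hφ.2 1
    rcases hform with h | h
    · exact ⟨A, by rw [← h, hA]⟩
    · exact ⟨Aᵀ, by rw [← h, hA]⟩
  have hdet : P.det * C.det * Q.det = 1 := by
    rw [← Matrix.det_mul, ← Matrix.det_mul, hC, Matrix.det_one]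
  have hP : IsUnit P.det := isUnit_iff_ne_zero.mpr fun h => by simp [h] at hdet
  have hQ : IsUnit Q.det := isUnit_iff_ne_zero.mpr fun h => by simp [h] at hdet
  obtain ⟨R, rfl⟩ := (Matrix.isUnit_iff_isUnit_det P).mpr hP
  have hscalar : φ '' realLogSet n = realLogSet n →
      ∃ c : ℝ, 0 < c ∧ Q * (R : Matrix (Fin n) (Fin n) ℝ) = c • 1 := fun himg => by
    refine Matrix.exists_pos_eq_smul_one_of_mul_mem_realLogSet
      (by rw [Matrix.det_mul]; exact hQ.mul hP) fun A hA => ?_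
    have hmem : (R : Matrix (Fin n) (Fin n) ℝ) * A * Q ∈ realLogSet n := by
      rcases hform with h | h
      · rw [← h, ← himg]
        exact ⟨A, hA, rfl⟩
      · rw [← himg]
        exact ⟨Aᵀ, Matrix.transpose_mem_realLogSet hA, by rw [h, Matrix.transpose_transpose]⟩
    -- R⁻¹(RAQ)R = A(QR).
    have := Matrix.conj_mem_realLogSet R⁻¹ hmem
    rwa [inv_inv, ← mul_assoc, ← mul_assoc, Units.inv_mul, one_mul, mul_assoc] at this
  refine ⟨⟨fun himg => ?_, fun ⟨R, c, hc, h⟩ => image_realLogSet_eq_of_smul_conj hc h⟩, hscalar⟩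
  obtain ⟨c, hc, hQP⟩ := hscalar himg
  have hQR : Q = c • ((R⁻¹ : (Matrix (Fin n) (Fin n) ℝ)ˣ) : Matrix (Fin n) (Fin n) ℝ) := by
    rw [← Units.mul_inv_cancel_right Q R, hQP, smul_mul_assoc, one_mul]
  refine ⟨R, c, hc, hform.imp (fun h A => ?_) (fun h A => ?_)⟩
  all_goals rw [h, hQR, mul_smul_comm]
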